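/- Let $G$ be a finite group and let $(V_1,\rho_1),\dots,(V_k,\rho_k)$ be its irreducible finite-dimensional complex representations, one from each isomorphism class, with characters $\chi_1,\dots,\chi_k$. Let $Q$ be a probability distribution on $G$ which is constant on the conjugacy classes of $G$, and let $Q=\sum_{j=1}^k a_j\chi_j$, $a_j\in\mathbb{C}$, be its unique representation as a linear combination of irreducible characters. For an integer $N\ge 0$ let $Q^{N}$ be the $N$-fold convolution of $Q$, where $(P*R)(h)=\sum_{g\in G}P(hg^{-1})R(g)$ and $Q^{0}$ is the point mass at the identity, and put $q^{(N)}=\sum_{g\in G}Q^{N}(g)\,e_g\in\mathbb{C}G$. Let $X$ be a set on which $G$ acts transitively and let $x_0\in X$. Let $\mathbb{C}X$ be the permutation module with basis $\{e_x:x\in X\}$ and action $e_g\cdot e_x=e_{g(x)}$, let $\mathbb{C}X\cong\bigoplus_{j}V_j^{m(V_j,\mathbb{C}X)}$ be its decomposition into irreducibles (which exists, with uniquely determined multiplicities $m(V_j,\mathbb{C}X)$), let $\overline{u}_X=\frac{1}{|X|}\sum_{x\in X}e_x$, and let $\|h\|_{\rm TV}=\frac12\sum_{x\in X}|h(x)|$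 for $h=\sum_{x}h(x)e_x\in\mathbb{C}X$. Then \[\|q^{(N)}\cdot e_{x_0}-\overline{u}_X\|_{\rm TV}^2\leq \frac14\sum_{V_j\neq{\rm triv}}m(V_j,\mathbb{C}X)\,\dim(V_j)\left(\frac{|a_j|\,|G|}{\dim(V_j)}\right)^{2N},\] where the sum is over the $V_j$ not isomorphic to the one-dimensional trivial representation, and a $0$-th power is $1$. -/

import Mathlib

namespace ConjWalk

universe u v w

/-- `ρ` lists the irreducible complex representations of `G`, each isomorphism class exactly once.
Every finite-dimensional complex representation is isomorphic to one on a space in `Type`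
(namely some `ℂⁿ`), so it is enough to let `W` range over `Type` in the last clause. -/
structure IsIrrepList {G : Type u} [Group G] {ι : Type w} {V : ι → Type v}
    [∀ j, AddCommGroup (V j)] [∀ j, Module ℂ (V j)]
    (ρ : ∀ j, Representation ℂ G (V j)) : Prop where
  irreducible : ∀ j, (ρ j).IsIrreducible
  distinct : ∀ i j, Nonempty ((ρ i).Equiv (ρ j)) → i = j
  complete : ∀ (W : Type) [AddCommGroup W] [Module ℂ W] [FiniteDimensional ℂ W]
    (σ : Representation ℂ G W), σ.IsIrreducible → ∃ j, Nonempty (σ.Equiv (ρ j))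

/-- `m j` are the multiplicities of the `V j` in the representation `σ`:
`σ ≅ ⨁ j, (V j) ^ (m j)`. -/
def IsMultiplicities {G : Type u} [Group G] {ι : Type w} {V : ι → Type v}
    [∀ j, AddCommGroup (V j)] [∀ j, Module ℂ (V j)]
    (ρ : ∀ j, Representation ℂ G (V j))
    {W : Type*} [AddCommGroup W] [Module ℂ W] (σ : Representation ℂ G W) (m : ι → ℕ) : Prop :=
  Nonempty (σ.Equiv (Representation.directSum fun p : (Σ j, Fin (m j)) => ρ p.1))

/-- The representation is isomorphic to the one-dimensional trivial representation. -/
def IsTrivialRep {G : Type u} [Group G] {W : Type*} [AddCommGroup W] [Module ℂ W]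
    (σ : Representation ℂ G W) : Prop :=
  Nonempty (σ.Equiv (Representation.trivial ℂ G ℂ))

/-- Convolution `(P ∗ Q)(h) = ∑ g, P (h g⁻¹) Q g` of functions on a finite group. -/
def conv {G : Type u} [Group G] [Fintype G] (P Q : G → ℝ) : G → ℝ :=
  fun h => ∑ g, P (h * g⁻¹) * Q g

open Classical in
/-- The `N`-fold convolution `Q ∗ ⋯ ∗ Q`; the `0`-fold one is the point mass at the identity. -/
noncomputable def convPow {G : Type u} [Group G] [Fintype G] (Q : G → ℝ) : ℕ → G → ℝ
  | 0 => Pi.single 1 1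
  | N + 1 => conv Q (convPow Q N)

/-- The element `∑ g, Q g • e_g` of the group algebra `ℂ G`. -/
noncomputable def toGroupAlgebra {G : Type u} [Fintype G] (Q : G → ℝ) : MonoidAlgebra ℂ G :=
  ∑ g, MonoidAlgebra.single g (Q g : ℂ)

/-- The basis vector `e_x` of `ℂ X` (as a vector space, `MonoidAlgebra ℂ X` is the space with
basis `X`; no multiplication on `X` is used). -/
noncomputable def basisVec {X : Type v} (x : X) : MonoidAlgebra ℂ X :=
  MonoidAlgebra.single x 1

/-- The action of the group algebra on the permutation module, `e_g · e_x = e_{g x}`. -/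
noncomputable def act {G : Type u} [Group G] {X : Type v} [MulAction G X]
    (q : MonoidAlgebra ℂ G) (t : MonoidAlgebra ℂ X) : MonoidAlgebra ℂ X :=
  (Representation.ofMulAction ℂ G X).asAlgebraHom q t

/-- The uniform distribution `(1 / |X|) ∑ x, e_x` as an element of `ℂ X`. -/
noncomputable def uniformVec (X : Type v) [Fintype X] : MonoidAlgebra ℂ X :=
  (1 / (Fintype.card X : ℂ)) • ∑ x : X, basisVec x

/-- The total variation norm `(1 / 2) ∑ x, |h x|` on `ℂ X`. -/
noncomputable def tvNorm {X : Type v} [Fintype X] (h : MonoidAlgebra ℂ X) : ℝ :=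
  (1 / 2) * ∑ x : X, ‖h.coeff x‖

end ConjWalk

/-! The difference from uniform is `opSum B` applied to `e_{x₀}`, where `B = Q^N - 1/|G|` is a real
class function. Cauchy–Schwarz (`tvNorm_sq_le`) bounds its squared total variation norm by `|X|/4`
times its squared ℓ² norm. Since `opSum B` commutes with `G` and `G` is transitive, every column of
its matrix has the same ℓ² norm (`sum_norm_sq_opSum_single`), so the factor `|X|` turns the bound
into the full Hilbert–Schmidt norm, with no loss.

That norm is the trace of `opSum (B ∘ inv) * opSum B`, which splits over the irreducible
constituents (`sum_sum_norm_sq_eq`). By Schur's lemma `opSum B` acts on `V_j` as a scalar: `0` if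
`V_j` is trivial, otherwise the `N`-th power of a scalar of modulus `|a_j||G|/dim V_j`. Each copy of
`V_j` contributes `dim V_j` times the squared modulus. -/

namespace ConjWalk

open Representation

/-! ### Representations as modules over the group algebra -/

section Decomposition

variable {k G V W : Type*} [Field k] [Group G] [AddCommGroup V] [Module k V]
  [AddCommGroup W] [Module k W]

theorem isIrreducible_of_equiv {σ : Representation k G V} {τ : Representation k G W}
    (φ : σ.Equiv τ) (hσ : σ.IsIrreducible) : τ.IsIrreducible := by
  rw [irreducible_iff_isSimpleModule_asModule] at hσ ⊢
  exact IsSimpleModule.congr (LinearEquiv.ofBijective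
    (IntertwiningMap.equivLinearMapAsModule σ τ φ.toIntertwiningMap) φ.toLinearEquiv.bijective).symm

theorem nontrivial_of_isIrreducible {σ : Representation k G V} (hσ : σ.IsIrreducible) :
    Nontrivial V := by
  have : IsSimpleModule (MonoidAlgebra k G) σ.asModule :=
    (irreducible_iff_isSimpleModule_asModule σ).1 hσ
  exact IsSimpleModule.nontrivial (MonoidAlgebra k G) σ.asModule

theorem trace_directSum_lmap {κ : Type*} [Fintype κ] {U : κ → Type*}
    [∀ i, AddCommGroup (U i)] [∀ i, Module k (U i)] [∀ i, FiniteDimensional k (U i)]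
    (T : ∀ i, U i →ₗ[k] U i) :
    LinearMap.trace k _ (DirectSum.lmap T) = ∑ i, LinearMap.trace k (U i) (T i) := by
  classical
  have hid : DirectSum.lmap T = ∑ i, DirectSum.lof k κ U i ∘ₗ
      (DirectSum.component k κ U i ∘ₗ DirectSum.lmap T) := by
    refine LinearMap.ext fun v => ?_
    simp only [LinearMap.sum_apply, LinearMap.comp_apply, DirectSum.lof_eq_of]
    exact (DirectSum.sum_univ_of (DirectSum.lmap T v)).symm
  have hcomp : ∀ i, DirectSum.component k κ U i ∘ₗ DirectSum.lmap T ∘ₗ DirectSum.lof k κ U i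
      = T i := by
    intro i
    ext x
    simp [DirectSum.component.lof_self]
  have (i : κ) : Module.Free k (U i) := inferInstance
  rw [hid, map_sum]
  refine Finset.sum_congr rfl fun i _ => ?_
  rw [← hcomp i, ← LinearMap.comp_assoc (DirectSum.lof k κ U i), LinearMap.trace_comp_comm']

theorem ofModule'_apply (M : Type*) [AddCommGroup M] [Module k M] [Module (MonoidAlgebra k G) M]
    [IsScalarTower k (MonoidAlgebra k G) M] (g : G) (x : M) :
    (ofModule' M : Representation k G M) g x = MonoidAlgebra.single g (1 : k) • x := rfl

theorem asAlgebraHom_ofModule' (M : Type*) [AddCommGroup M] [Module k M]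
    [Module (MonoidAlgebra k G) M] [IsScalarTower k (MonoidAlgebra k G) M]
    (r : MonoidAlgebra k G) (x : M) :
    (ofModule' M : Representation k G M).asAlgebraHom r x = r • x := by
  induction r using MonoidAlgebra.induction_linear with
  | zero => simp
  | add a b ha hb => simp [add_smul, ha, hb]
  | single g a =>
    rw [asAlgebraHom_single, LinearMap.smul_apply, ofModule'_apply, ← smul_assoc,
      MonoidAlgebra.smul_single, smul_eq_mul, mul_one]

theorem isIrreducible_ofModule' (M : Type*) [AddCommGroup M] [Module k M]
    [Module (MonoidAlgebra k G) M] [IsScalarTower k (MonoidAlgebra k G) M]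
    (hM : IsSimpleModule (MonoidAlgebra k G) M) :
    (ofModule' M : Representation k G M).IsIrreducible := by
  rw [irreducible_iff_isSimpleModule_asModule]
  let f : (ofModule' M : Representation k G M).asModule ≃ₗ[MonoidAlgebra k G] M :=
    { (asModuleEquiv (ofModule' M : Representation k G M)).toAddEquiv with
      map_smul' := fun r x => asAlgebraHom_ofModule' M r _ }
  exact IsSimpleModule.congr f

end Decomposition

/-! ### Existence of the decomposition into irreducibles -/

section IrrepList

variable {G : Type*} [Group G] {ι : Type*} {V : ι → Type*}
  [∀ j, AddCommGroup (V j)] [∀ j, Module ℂ (V j)] {ρ : ∀ j, Representation ℂ G (V j)}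

/-- Transport to `ℂⁿ` removes the universe restriction in `complete`. -/
theorem IsIrrepList.exists_equiv (hρ : IsIrrepList ρ) {W : Type*} [AddCommGroup W] [Module ℂ W]
    [FiniteDimensional ℂ W] {σ : Representation ℂ G W} (hσ : σ.IsIrreducible) :
    ∃ j, Nonempty (σ.Equiv (ρ j)) := by
  let b := (Module.finBasis ℂ W).equivFun
  let τ : Representation ℂ G (Fin (Module.finrank ℂ W) → ℂ) :=
    (b.conjAlgEquiv ℂ : Module.End ℂ W →* _).comp σ
  let φ : σ.Equiv τ := Representation.Equiv.mk b fun g => by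
    ext v i
    simp [τ]
  obtain ⟨j, ⟨ψ⟩⟩ := hρ.complete _ τ (isIrreducible_of_equiv φ hσ)
  exact ⟨j, ⟨φ.trans ψ⟩⟩

theorem IsIrrepList.exists_isMultiplicities [Finite G] [Fintype ι] (hρ : IsIrrepList ρ) {W : Type*}
    [AddCommGroup W] [Module ℂ W] [FiniteDimensional ℂ W] (σ : Representation ℂ G W) :
    ∃ m, IsMultiplicities ρ σ m := by
  classical
  have : NeZero (Nat.card G : ℂ) := ⟨Nat.cast_ne_zero.2 Nat.card_pos.ne'⟩
  have : Module.Finite (MonoidAlgebra ℂ G) σ.asModule :=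
    Module.Finite.of_restrictScalars_finite ℂ _ _
  obtain ⟨n, S, e, hS⟩ :=
    IsSemisimpleModule.exists_linearEquiv_fin_dfinsupp (MonoidAlgebra ℂ G) σ.asModule
  have (i : Fin n) : FiniteDimensional ℂ (S i) :=
    FiniteDimensional.finiteDimensional_submodule ((S i).restrictScalars ℂ)
  choose j hj using fun i => hρ.exists_equiv (isIrreducible_ofModule' (k := ℂ) (S i) (hS i))
  let φ := fun i => (hj i).some
  let m : ι → ℕ := fun l => Fintype.card {i // j i = l}
  -- Maschke's theorem gives simple summands indexed by `Fin n`; grouping them by isomorphism class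
  -- yields the multiplicities.
  let r : Fin n ≃ Σ l, Fin (m l) := (Equiv.sigmaFiberEquiv j).symm.trans
    (Equiv.sigmaCongrRight fun l => Fintype.equivFin {i // j i = l})
  let a : W ≃ₗ[ℂ] (∀ i, S i) := σ.asModuleEquiv.symm ≪≫ₗ (e.restrictScalars ℂ) ≪≫ₗ
    DFinsupp.linearEquivFunOnFintype
  have ha : ∀ g v i, a (σ g v) i = (ofModule' (S i) : Representation ℂ G (S i)) g (a v i) := by
    intro g v i
    have h := map_smul e (MonoidAlgebra.of ℂ G g) (σ.asModuleEquiv.symm v)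
    rw [← asModuleEquiv_symm_map_rho] at h
    exact congrArg (fun w => w i) h
  let b : (∀ i, S i) ≃ₗ[ℂ] (∀ i, V (j i)) := LinearEquiv.piCongrRight fun i => (φ i).toLinearEquiv
  let c : (∀ i, V (j i)) ≃ₗ[ℂ] (∀ p : Σ l, Fin (m l), V p.1) :=
    LinearEquiv.piCongrLeft ℂ (fun p : Σ l, Fin (m l) => V p.1) r
  let d := DirectSum.linearEquivFunOnFintype ℂ (Σ l, Fin (m l)) (fun p => V p.1)
  have hc : ∀ w i, c w (r i) = w i := fun w i =>
    Equiv.piCongrLeft_apply_apply (fun p : Σ l, Fin (m l) => V p.1) r w i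
  refine ⟨m, ⟨Representation.Equiv.mk (a ≪≫ₗ b ≪≫ₗ c ≪≫ₗ d.symm) fun g => ?_⟩⟩
  refine LinearMap.ext fun v => d.injective ?_
  funext p
  obtain ⟨i, rfl⟩ := r.surjective p
  have hd : ∀ w, d (directSum (fun p : Σ l, Fin (m l) => ρ p.1) g w) (r i) =
      ρ (r i).1 g (d w (r i)) := fun w => rfl
  simp only [LinearMap.comp_apply, LinearEquiv.coe_coe, LinearEquiv.trans_apply, hd,
    LinearEquiv.apply_symm_apply, hc]
  exact (congrArg (φ i) (ha g v i)).trans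
    (IntertwiningMap.isIntertwining _ _ (φ i).toIntertwiningMap g (a v i))

end IrrepList

/-! ### Characters: conjugation, orthogonality, uniqueness -/

section Characters

/-- Weyl's averaging: `H = ∑ (M h)ᴴ M h` is an invariant positive definite form, so `(M g)ᴴ` is
conjugate to `M g⁻¹` by `H`. -/
theorem conj_character {G W : Type*} [Group G] [Fintype G] [AddCommGroup W] [Module ℂ W]
    [FiniteDimensional ℂ W] (σ : Representation ℂ G W) (g : G) :
    (starRingEnd ℂ) (σ.character g) = σ.character g⁻¹ := by
  classical
  open scoped ComplexOrder Matrix in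
  let b := Module.finBasis ℂ W
  let M : G → Matrix _ _ ℂ := fun g => LinearMap.toMatrix b b (σ g)
  have hM : ∀ g h, M (g * h) = M g * M h := fun g h => by
    simp only [M, map_mul, LinearMap.toMatrix_mul]
  have hM1 : M 1 = 1 := by simp [M]
  have htr : ∀ g, σ.character g = (M g).trace := fun g =>
    LinearMap.trace_eq_matrix_trace ℂ b (σ g)
  let H := ∑ h, (M h)ᴴ * M h
  have hH : (M g)ᴴ * H * M g = H := by
    simp only [H, Finset.mul_sum, Finset.sum_mul]
    refine Fintype.sum_equiv (Equiv.mulRight g) _ _ fun h => ?_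
    simp [hM, Matrix.conjTranspose_mul, mul_assoc]
  have hpos : H.PosDef := by
    -- The term at `h = 1` alone makes the sum definite.
    have h1 : H = 1 + ∑ h ∈ Finset.univ.erase 1, (M h)ᴴ * M h := by
      simp only [H]
      rw [← Finset.add_sum_erase _ _ (Finset.mem_univ (1 : G)), hM1]
      simp
    rw [h1]
    exact Matrix.PosDef.one.add_posSemidef
      (Matrix.posSemidef_sum _ fun h _ => Matrix.posSemidef_conjTranspose_mul_self _)
  have hu : IsUnit H.det := (Matrix.isUnit_iff_isUnit_det _).1 hpos.isUnit
  have hinv : M g * M g⁻¹ = 1 := by rw [← hM, mul_inv_cancel, hM1]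
  have key : (M g)ᴴ = H * M g⁻¹ * H⁻¹ := by
    calc (M g)ᴴ = (M g)ᴴ * H * (M g * M g⁻¹) * H⁻¹ := by
          rw [hinv, mul_one, Matrix.mul_nonsing_inv_cancel_right _ _ hu]
      _ = _ := by rw [← mul_assoc, hH]
  rw [htr, htr, starRingEnd_apply, ← Matrix.trace_conjTranspose, key, Matrix.trace_mul_comm,
    Matrix.nonsing_inv_mul_cancel_left _ _ hu]

variable {G : Type*} [Group G] {ι : Type*} {V : ι → Type*}
  [∀ j, AddCommGroup (V j)] [∀ j, Module ℂ (V j)] [∀ j, FiniteDimensional ℂ (V j)]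
  {ρ : ∀ j, Representation ℂ G (V j)}

theorem IsMultiplicities.character_eq [Fintype ι] {W : Type*} [AddCommGroup W] [Module ℂ W]
    {σ : Representation ℂ G W} {m : ι → ℕ} (h : IsMultiplicities ρ σ m) (g : G) :
    σ.character g = ∑ j, m j * (ρ j).character g := by
  rw [char_iso h.some, character, directSum_apply, trace_directSum_lmap, Fintype.sum_sigma]
  refine Finset.sum_congr rfl fun j _ => ?_
  change ∑ _i : Fin (m j), (ρ j).character g = _
  rw [Finset.sum_const, Finset.card_univ, Fintype.card_fin, nsmul_eq_mul]

open Classical in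
theorem IsIrrepList.sum_character_mul [Fintype G] (hρ : IsIrrepList ρ) (i j : ι) :
    ∑ g, (ρ i).character g * (ρ j).character g⁻¹ = if i = j then (Fintype.card G : ℂ) else 0 := by
  have := hρ.irreducible i
  have := hρ.irreducible j
  have hG : (Nat.card G : ℂ) ≠ 0 := Nat.cast_ne_zero.2 Nat.card_pos.ne'
  have : Invertible (Nat.card G : ℂ) := invertibleOfNonzero hG
  have h := char_orthonormal (ρ i) (ρ j)
  rw [inv_mul_eq_iff_eq_mul₀ hG] at h
  have hiff : Nonempty ((ρ j).Equiv (ρ i)) ↔ i = j :=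
    ⟨fun ⟨φ⟩ => (hρ.distinct j i ⟨φ⟩).symm, by rintro rfl; exact ⟨.refl _⟩⟩
  rw [h]
  simp [hiff]

theorem IsIrrepList.sum_mul_character_inv [Fintype G] [Fintype ι] (hρ : IsIrrepList ρ) (a : ι → ℂ)
    (j : ι) : ∑ g, (∑ i, a i * (ρ i).character g) * (ρ j).character g⁻¹ = Fintype.card G * a j := by
  classical
  simp only [Finset.sum_mul]
  rw [Finset.sum_comm]
  simp only [mul_assoc, ← Finset.mul_sum, hρ.sum_character_mul]
  simp [mul_comm]

theorem IsIrrepList.coeff_unique [Fintype G] [Fintype ι] (hρ : IsIrrepList ρ) {a b : ι → ℂ}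
    (h : ∀ g, ∑ j, a j * (ρ j).character g = ∑ j, b j * (ρ j).character g) : a = b := by
  funext j
  have hG : (Fintype.card G : ℂ) ≠ 0 := Nat.cast_ne_zero.2 Fintype.card_ne_zero
  refine mul_left_cancel₀ hG ?_
  simp only [← hρ.sum_mul_character_inv, h]

theorem IsIrrepList.existsUnique_isMultiplicities [Fintype G] [Fintype ι] (hρ : IsIrrepList ρ)
    {W : Type*} [AddCommGroup W] [Module ℂ W] [FiniteDimensional ℂ W] (σ : Representation ℂ G W) :
    ∃! m, IsMultiplicities ρ σ m := by
  refine existsUnique_of_exists_of_unique (hρ.exists_isMultiplicities σ) fun m n hm hn => ?_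
  have := hρ.coeff_unique (a := fun j => (m j : ℂ)) (b := fun j => (n j : ℂ)) fun g => by
    rw [← hm.character_eq, ← hn.character_eq]
  funext j
  exact Nat.cast_injective (congrFun this j)

end Characters

/-! ### Operators of class functions -/

section ClassFunctions

variable {G : Type*} [Group G] [Fintype G]

/-- The operator `∑ g, f g • σ g` by which the function `f` acts in the representation `σ`. -/
noncomputable def opSum {W : Type*} [AddCommGroup W] [Module ℂ W] (σ : Representation ℂ G W)
    (f : G → ℂ) : W →ₗ[ℂ] W :=
  ∑ g, f g • σ g

variable {W : Type*} [AddCommGroup W] [Module ℂ W] (σ : Representation ℂ G W)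

theorem trace_opSum (f : G → ℂ) :
    LinearMap.trace ℂ W (opSum σ f) = ∑ g, f g * σ.character g := by
  simp [opSum, character]

theorem opSum_comp_apply {f : G → ℂ} (hf : ∀ g h, f (h * g * h⁻¹) = f g) (h : G) :
    opSum σ f * σ h = σ h * opSum σ f := by
  simp only [opSum, Finset.sum_mul, Finset.mul_sum, smul_mul_assoc, mul_smul_comm, ← map_mul]
  refine (Fintype.sum_equiv (MulAut.conj h).toEquiv _ _ fun g => ?_).symm
  simp [hf]

/-- Schur's lemma gives a scalar, and the trace determines it. -/
theorem opSum_eq_smul [FiniteDimensional ℂ W] {σ : Representation ℂ G W} (hσ : σ.IsIrreducible)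
    {f : G → ℂ} (hf : ∀ g h, f (h * g * h⁻¹) = f g) :
    opSum σ f = ((∑ g, f g * σ.character g) / Module.finrank ℂ W) • (1 : W →ₗ[ℂ] W) := by
  let T : IntertwiningMap σ σ := ⟨opSum σ f, opSum_comp_apply σ hf⟩
  obtain ⟨c, hc⟩ := (IsIrreducible.algebraMap_intertwiningMap_bijective_of_isAlgClosed (ρ := σ)).2 T
  have hT : opSum σ f = c • (1 : W →ₗ[ℂ] W) := by
    refine LinearMap.ext fun w => ?_
    exact (congrArg (fun S : IntertwiningMap σ σ => S w) hc).symm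
  have := nontrivial_of_isIrreducible hσ
  have hd : (Module.finrank ℂ W : ℂ) ≠ 0 := Nat.cast_ne_zero.2 Module.finrank_pos.ne'
  rw [← trace_opSum, hT, map_smul, LinearMap.trace_one, smul_eq_mul, mul_div_cancel_right₀ _ hd]

theorem trace_opSum_mul (f f' : G → ℂ) :
    LinearMap.trace ℂ W (opSum σ f * opSum σ f') =
      ∑ g, ∑ h, f g * f' h * σ.character (g * h) := by
  simp only [opSum, character, Finset.sum_mul, Finset.mul_sum, map_sum, smul_mul_smul_comm,
    ← map_mul, map_smul, smul_eq_mul]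
  exact Finset.sum_comm

/-- The trace depends only on the character, which is additive, so no operator has to be carried
through the isomorphism. -/
theorem IsMultiplicities.trace_opSum_mul {ι : Type*} [Fintype ι] {V : ι → Type*}
    [∀ j, AddCommGroup (V j)] [∀ j, Module ℂ (V j)] [∀ j, FiniteDimensional ℂ (V j)]
    {ρ : ∀ j, Representation ℂ G (V j)} {σ : Representation ℂ G W} {m : ι → ℕ}
    (hm : IsMultiplicities ρ σ m) (f f' : G → ℂ) :
    LinearMap.trace ℂ W (opSum σ f * opSum σ f') =
      ∑ j, m j * LinearMap.trace ℂ (V j) (opSum (ρ j) f * opSum (ρ j) f') := by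
  simp only [ConjWalk.trace_opSum_mul, hm.character_eq, Finset.mul_sum]
  rw [Finset.sum_comm]
  refine (Finset.sum_congr rfl fun h _ => Finset.sum_comm).trans ?_
  rw [Finset.sum_comm]
  refine Finset.sum_congr rfl fun j _ => ?_
  rw [Finset.sum_comm]
  refine Finset.sum_congr rfl fun g _ => Finset.sum_congr rfl fun h _ => ?_
  ring

end ClassFunctions

/-! ### Traces on permutation modules -/

section Permutation

variable {G X : Type*} [Group G] [MulAction G X] [Fintype X]

theorem trace_eq_sum_coeff (T : MonoidAlgebra ℂ X →ₗ[ℂ] MonoidAlgebra ℂ X) :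
    LinearMap.trace ℂ _ T = ∑ x, (T (MonoidAlgebra.single x 1)).coeff x := by
  classical
  rw [LinearMap.trace_eq_matrix_trace ℂ (MonoidAlgebra.basis X ℂ), Matrix.trace]
  refine Finset.sum_congr rfl fun x _ => ?_
  rw [Matrix.diag, LinearMap.toMatrix_apply, MonoidAlgebra.basis_apply]
  rfl

theorem apply_eq_sum_coeff_smul (T : MonoidAlgebra ℂ X →ₗ[ℂ] MonoidAlgebra ℂ X)
    (v : MonoidAlgebra ℂ X) : T v = ∑ y, v.coeff y • T (MonoidAlgebra.single y 1) := by
  classical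
  conv_lhs => rw [← (MonoidAlgebra.basis X ℂ).sum_repr v]
  simp only [map_sum, map_smul, MonoidAlgebra.basis_apply]
  rfl

open Classical in
omit [Fintype X] in
theorem coeff_opSum_single [Fintype G] (f : G → ℂ) (x y : X) :
    (opSum (ofMulAction ℂ G X) f (MonoidAlgebra.single x 1)).coeff y =
      ∑ g, if g • x = y then f g else 0 := by
  simp [opSum, MonoidAlgebra.coeff_sum, Finsupp.finsetSum_apply,
    Finsupp.single_apply]

/-- In the basis `e_x`, inverting the argument of `B` transposes the matrix; as `B` is real, this is
the adjoint. -/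
theorem trace_opSum_inv_mul_opSum [Fintype G] (B : G → ℝ) :
    LinearMap.trace ℂ _ (opSum (ofMulAction ℂ G X) (fun g => (B g⁻¹ : ℂ)) *
        opSum (ofMulAction ℂ G X) (fun g => (B g : ℂ))) =
      ((∑ x : X, ∑ y, ‖(opSum (ofMulAction ℂ G X) (fun g => (B g : ℂ))
        (MonoidAlgebra.single x 1)).coeff y‖ ^ 2 : ℝ) : ℂ) := by
  classical
  rw [trace_eq_sum_coeff, Complex.ofReal_sum]
  refine Finset.sum_congr rfl fun x _ => ?_
  rw [Module.End.mul_apply, apply_eq_sum_coeff_smul, MonoidAlgebra.coeff_sum,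
    Finsupp.finsetSum_apply, Complex.ofReal_sum]
  refine Finset.sum_congr rfl fun y _ => ?_
  rw [MonoidAlgebra.coeff_smul_apply, smul_eq_mul, Complex.ofReal_pow, ← Complex.mul_conj']
  congr 1
  rw [coeff_opSum_single, coeff_opSum_single, map_sum]
  refine Fintype.sum_equiv (Equiv.inv G) _ _ fun g => ?_
  by_cases h : g • y = x
  · have h' : g⁻¹ • x = y := by rw [← h, inv_smul_smul]
    simp [h, h']
  · have h' : ¬ g⁻¹ • x = y := fun h' => h (by rw [← h', smul_inv_smul])
    simp [h, h']

theorem character_leftRegular (G : Type*) [Group G] [Fintype G] [DecidableEq G] (g : G) :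
    (leftRegular ℂ G).character g = if g = 1 then (Fintype.card G : ℂ) else 0 := by
  rw [character, trace_eq_sum_coeff]
  simp only [ofMulAction_single, MonoidAlgebra.coeff_single, Finsupp.single_apply, smul_eq_mul, mul_eq_right]
  split_ifs <;> simp

end Permutation

/-! ### Irreducible characters span the class functions -/

section Expansion

variable {G : Type*} [Group G] [Fintype G] {ι : Type*} [Fintype ι] {V : ι → Type*}
  [∀ j, AddCommGroup (V j)] [∀ j, Module ℂ (V j)] [∀ j, FiniteDimensional ℂ (V j)]
  {ρ : ∀ j, Representation ℂ G (V j)}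

/-- By Schur `f` acts as zero on every irreducible, hence has zero traces on the regular
representation; pairing with the point mass at `h⁻¹` reads off `|G| f h`. -/
theorem IsIrrepList.eq_zero_of_sum_eq_zero (hρ : IsIrrepList ρ) {f : G → ℂ}
    (hf : ∀ g h, f (h * g * h⁻¹) = f g) (h0 : ∀ j, ∑ g, f g * (ρ j).character g = 0) : f = 0 := by
  classical
  have hop : ∀ j, opSum (ρ j) f = 0 := fun j => by
    rw [opSum_eq_smul (hρ.irreducible j) hf, h0, zero_div, zero_smul]
  obtain ⟨m, hm⟩ := hρ.exists_isMultiplicities (leftRegular ℂ G)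
  funext h
  have key := hm.trace_opSum_mul f (Pi.single h⁻¹ 1)
  simp only [hop, zero_mul, map_zero, mul_zero, Finset.sum_const_zero] at key
  rw [trace_opSum_mul, Finset.sum_comm] at key
  simpa [character_leftRegular, Pi.single_apply, mul_eq_one_iff_eq_inv] using key

theorem IsIrrepList.existsUnique_coeff (hρ : IsIrrepList ρ) {f : G → ℂ}
    (hf : ∀ g h, f (h * g * h⁻¹) = f g) :
    ∃! a : ι → ℂ, ∀ g, f g = ∑ j, a j * (ρ j).character g := by
  have hG : (Fintype.card G : ℂ) ≠ 0 := Nat.cast_ne_zero.2 Fintype.card_ne_zero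
  refine existsUnique_of_exists_of_unique ?_
    fun a b ha hb => hρ.coeff_unique fun g => by rw [← ha, ← hb]
  let a : ι → ℂ := fun j => (Fintype.card G : ℂ)⁻¹ * ∑ g, f g * (ρ j).character g⁻¹
  refine ⟨a, ?_⟩
  -- Arguments are inverted because the vanishing criterion pairs with `χ g`, while orthogonality
  -- pairs with `χ g⁻¹`.
  have key := hρ.eq_zero_of_sum_eq_zero
    (f := fun g => f g⁻¹ - ∑ j, a j * (ρ j).character g⁻¹) (fun g h => ?_) fun j => ?_
  · intro g
    simpa [sub_eq_zero] using congrFun key g⁻¹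
  · have : (h * g * h⁻¹)⁻¹ = h * g⁻¹ * h⁻¹ := by group
    simp only [this, hf, char_conj]
  · rw [← Equiv.sum_comp (Equiv.inv G)]
    simp only [Equiv.inv_apply, inv_inv, sub_mul, Finset.sum_sub_distrib,
      hρ.sum_mul_character_inv, a]
    rw [mul_inv_cancel_left₀ hG, sub_self]

end Expansion

/-! ### Convolution powers become operator powers -/

section Convolution

variable {G : Type*} [Group G] [Fintype G]

theorem conv_conj_eq {P Q : G → ℝ} (hP : ∀ g h, P (h * g * h⁻¹) = P g)
    (hQ : ∀ g h, Q (h * g * h⁻¹) = Q g) (g h : G) : conv P Q (h * g * h⁻¹) = conv P Q g := by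
  refine (Fintype.sum_equiv (MulAut.conj h).toEquiv _ _ fun x => ?_).symm
  have : h * g * h⁻¹ * (h * x * h⁻¹)⁻¹ = h * (g * x⁻¹) * h⁻¹ := by group
  change P (g * x⁻¹) * Q x = P (h * g * h⁻¹ * (h * x * h⁻¹)⁻¹) * Q (h * x * h⁻¹)
  rw [this, hP, hQ]

theorem convPow_conj_eq {Q : G → ℝ} (hQ : ∀ g h, Q (h * g * h⁻¹) = Q g) (N : ℕ) (g h : G) :
    convPow Q N (h * g * h⁻¹) = convPow Q N g := by
  induction N generalizing g h with
  | zero =>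
    classical
    simp only [convPow, Pi.single_apply]
    exact if_congr conj_eq_one_iff rfl rfl
  | succ N ih => exact conv_conj_eq hQ ih g h

theorem sum_conv (P Q : G → ℝ) : ∑ g, conv P Q g = (∑ g, P g) * ∑ g, Q g := by
  simp only [conv]
  rw [Finset.sum_comm, Finset.mul_sum]
  refine Finset.sum_congr rfl fun g _ => ?_
  rw [← Finset.sum_mul]
  congr 1
  exact Equiv.sum_comp (Equiv.mulRight g⁻¹) P

theorem sum_convPow {Q : G → ℝ} (hQ : ∑ g, Q g = 1) (N : ℕ) : ∑ g, convPow Q N g = 1 := by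
  induction N with
  | zero => simp [convPow]
  | succ N ih => rw [convPow, sum_conv, hQ, ih, mul_one]

variable {W : Type*} [AddCommGroup W] [Module ℂ W] (σ : Representation ℂ G W)

theorem asAlgebraHom_toGroupAlgebra (Q : G → ℝ) :
    σ.asAlgebraHom (toGroupAlgebra Q) = opSum σ fun g => (Q g : ℂ) := by
  simp [toGroupAlgebra, opSum]

theorem opSum_conv (P Q : G → ℝ) :
    opSum σ (fun g => (conv P Q g : ℂ)) =
      opSum σ (fun g => (P g : ℂ)) * opSum σ fun g => (Q g : ℂ) := by
  simp only [opSum, conv, Finset.sum_mul, Finset.mul_sum, smul_mul_smul_comm, ← map_mul,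
    Complex.ofReal_sum, Complex.ofReal_mul, Finset.sum_smul]
  rw [Finset.sum_comm]
  refine Finset.sum_congr rfl fun h _ => ?_
  refine Fintype.sum_equiv (Equiv.mulRight h⁻¹) _ _ fun g => ?_
  simp

theorem opSum_convPow (Q : G → ℝ) (N : ℕ) :
    opSum σ (fun g => (convPow Q N g : ℂ)) = (opSum σ fun g => (Q g : ℂ)) ^ N := by
  induction N with
  | zero =>
    classical
    rw [pow_zero, ← map_one σ]
    simp only [opSum, convPow, Pi.single_apply]
    rw [Finset.sum_eq_single 1 (by simp +contextual) (by simp)]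
    simp
  | succ N ih => rw [pow_succ', ← ih, ← opSum_conv]; rfl

theorem opSum_sub (f f' : G → ℂ) : opSum σ (fun g => f g - f' g) = opSum σ f - opSum σ f' := by
  simp [opSum, sub_smul]

end Convolution

/-! ### The uniform distribution -/

section Uniform

variable {G : Type*} [Group G] [Fintype G]

theorem apply_opSum_const {W : Type*} [AddCommGroup W] [Module ℂ W] (σ : Representation ℂ G W)
    (c : ℂ) (h : G) (w : W) : σ h (opSum σ (fun _ => c) w) = opSum σ (fun _ => c) w := by
  simp only [opSum, LinearMap.sum_apply, map_sum, LinearMap.smul_apply, map_smul]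
  refine Fintype.sum_equiv (Equiv.mulLeft h) _ _ fun g => ?_
  simp

/-- The image consists of invariant vectors; a nonzero one would span a copy of the trivial
representation. -/
theorem opSum_const_eq_zero {W : Type*} [AddCommGroup W] [Module ℂ W] {σ : Representation ℂ G W}
    (hσ : σ.IsIrreducible) (hnt : ¬ IsTrivialRep σ) (c : ℂ) : opSum σ (fun _ => c) = 0 := by
  refine LinearMap.ext fun w => by_contra fun hw => hnt ?_
  set v := opSum σ (fun _ => c) w with hv
  let T : IntertwiningMap (trivial ℂ G ℂ) σ := ⟨LinearMap.toSpanSingleton ℂ W v, fun g => by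
    ext
    simp [hv, apply_opSum_const]⟩
  have hT : ∀ z, T z = z • v := fun z => rfl
  refine ⟨(T.ofBijective ⟨fun x y hxy => ?_, ?_⟩).symm⟩
  · rw [hT, hT] at hxy
    exact smul_left_injective ℂ hw hxy
  · refine (IsIrreducible.surjective_or_eq_zero T).resolve_right fun h => hw ?_
    simpa [hT] using congrArg (fun S : IntertwiningMap _ σ => S 1) h

omit [Fintype G] in
theorem apply_eq_of_isTrivialRep {W : Type*} [AddCommGroup W] [Module ℂ W]
    {σ : Representation ℂ G W} (h : IsTrivialRep σ) (g : G) : σ g = 1 := by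
  obtain ⟨φ⟩ := h
  refine LinearMap.ext fun w => φ.toLinearEquiv.injective ?_
  exact IntertwiningMap.isIntertwining _ _ φ.toIntertwiningMap g w

/-- The average is invariant, so transitivity makes its coefficients equal, and they sum to one. -/
theorem uniformVec_eq {X : Type*} [Fintype X] [MulAction G X] [MulAction.IsPretransitive G X]
    (x : X) : uniformVec X = opSum (ofMulAction ℂ G X) (fun _ => (Fintype.card G : ℂ)⁻¹)
      (basisVec x) := by
  classical
  have hG : (Fintype.card G : ℂ) ≠ 0 := Nat.cast_ne_zero.2 Fintype.card_ne_zero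
  have : Nonempty X := ⟨x⟩
  have hX : (Fintype.card X : ℂ) ≠ 0 := Nat.cast_ne_zero.2 Fintype.card_ne_zero
  set v := opSum (ofMulAction ℂ G X) (fun _ => (Fintype.card G : ℂ)⁻¹) (basisVec x) with hv
  have hconst : ∀ y z, v.coeff y = v.coeff z := by
    intro y z
    obtain ⟨g, rfl⟩ := MulAction.exists_smul_eq G z y
    have h := apply_opSum_const (ofMulAction ℂ G X) (Fintype.card G : ℂ)⁻¹ g (basisVec x)
    rw [← hv] at h
    rw [← h, coeff_ofMulAction, inv_smul_smul, h]
  have hsum : ∑ y, v.coeff y = 1 := by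
    simp only [hv, basisVec, coeff_opSum_single]
    rw [Finset.sum_comm]
    simp [hG]
  have hval : ∀ y, v.coeff y = (Fintype.card X : ℂ)⁻¹ := by
    intro y
    rw [Finset.sum_congr rfl fun z _ => hconst z y] at hsum
    simp only [Finset.sum_const, Finset.card_univ, nsmul_eq_mul] at hsum
    exact eq_inv_of_mul_eq_one_right hsum
  ext y
  rw [hval]
  simp [uniformVec, basisVec, MonoidAlgebra.coeff_sum, Finsupp.single_apply]

end Uniform

/-! ### The Hilbert–Schmidt norm and the bound -/

section Bound

variable {G : Type*} [Group G] [Fintype G]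

theorem sum_norm_sq_opSum_single {X : Type*} [Fintype X] [MulAction G X]
    [MulAction.IsPretransitive G X] {f : G → ℂ} (hf : ∀ g h, f (h * g * h⁻¹) = f g) (x x' : X) :
    ∑ y, ‖(opSum (ofMulAction ℂ G X) f (MonoidAlgebra.single x 1)).coeff y‖ ^ 2 =
      ∑ y, ‖(opSum (ofMulAction ℂ G X) f (MonoidAlgebra.single x' 1)).coeff y‖ ^ 2 := by
  obtain ⟨g, rfl⟩ := MulAction.exists_smul_eq G x x'
  have h := LinearMap.congr_fun (opSum_comp_apply (ofMulAction ℂ G X) hf g)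
    (MonoidAlgebra.single x 1)
  simp only [Module.End.mul_apply, ofMulAction_single] at h
  rw [h]
  refine Fintype.sum_equiv (MulAction.toPerm g) _ _ fun y => ?_
  rw [MulAction.toPerm_apply, coeff_ofMulAction, inv_smul_smul]

theorem tvNorm_sq_le {X : Type*} [Fintype X] (v : MonoidAlgebra ℂ X) :
    tvNorm v ^ 2 ≤ 1 / 4 * (Fintype.card X * ∑ y, ‖v.coeff y‖ ^ 2) := by
  have h := sq_sum_le_card_mul_sum_sq (s := (Finset.univ : Finset X)) (f := fun y => ‖v.coeff y‖)
  rw [Finset.card_univ] at h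
  rw [tvNorm, mul_pow]
  norm_num
  exact h

/-- `B ∘ inv` acts by the conjugate scalar, since `B` is real and `χ g⁻¹` is the conjugate of `χ g`.
-/
theorem trace_opSum_inv_mul_opSum_irreducible {W : Type*} [AddCommGroup W] [Module ℂ W]
    [FiniteDimensional ℂ W] {σ : Representation ℂ G W} (hσ : σ.IsIrreducible) {B : G → ℝ}
    (hB : ∀ g h, B (h * g * h⁻¹) = B g) {c : ℂ}
    (hc : opSum σ (fun g => (B g : ℂ)) = c • (1 : W →ₗ[ℂ] W)) :
    LinearMap.trace ℂ W (opSum σ (fun g => (B g⁻¹ : ℂ)) * opSum σ (fun g => (B g : ℂ))) =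
      ((Module.finrank ℂ W * ‖c‖ ^ 2 : ℝ) : ℂ) := by
  have := nontrivial_of_isIrreducible hσ
  have hd : (Module.finrank ℂ W : ℂ) ≠ 0 := Nat.cast_ne_zero.2 Module.finrank_pos.ne'
  have htr := congrArg (LinearMap.trace ℂ W) hc
  rw [trace_opSum, map_smul, LinearMap.trace_one, smul_eq_mul] at htr
  have hinv : ∀ g h, ((B (h * g * h⁻¹)⁻¹ : ℝ) : ℂ) = B g⁻¹ := by
    intro g h
    rw [← hB g⁻¹ h]
    group
  have hsum : ∑ g, (B g⁻¹ : ℂ) * σ.character g =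
      (starRingEnd ℂ) c * Module.finrank ℂ W := by
    have := congrArg (starRingEnd ℂ) htr
    simp only [map_sum, map_mul, Complex.conj_ofReal, conj_character, map_natCast] at this
    rw [← this]
    refine Fintype.sum_equiv (Equiv.inv G) _ _ fun g => ?_
    simp
  rw [hc, opSum_eq_smul hσ hinv, hsum, mul_div_cancel_right₀ _ hd, smul_mul_smul_comm, map_smul,
    one_mul, LinearMap.trace_one, Complex.conj_mul', smul_eq_mul, mul_comm]
  push_cast
  rfl

theorem sum_sum_norm_sq_eq {ι : Type*} [Fintype ι] {V : ι → Type*}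
    [∀ j, AddCommGroup (V j)] [∀ j, Module ℂ (V j)] [∀ j, FiniteDimensional ℂ (V j)]
    {ρ : ∀ j, Representation ℂ G (V j)} (hρ : IsIrrepList ρ)
    {X : Type*} [Fintype X] [MulAction G X] {m : ι → ℕ}
    (hm : IsMultiplicities ρ (ofMulAction ℂ G X) m) {B : G → ℝ}
    (hB : ∀ g h, B (h * g * h⁻¹) = B g) {c : ι → ℂ}
    (hc : ∀ j, opSum (ρ j) (fun g => (B g : ℂ)) = c j • (1 : V j →ₗ[ℂ] V j)) :
    ∑ x : X, ∑ y, ‖(opSum (ofMulAction ℂ G X) (fun g => (B g : ℂ))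
        (MonoidAlgebra.single x 1)).coeff y‖ ^ 2 =
      ∑ j, (m j : ℝ) * Module.finrank ℂ (V j) * ‖c j‖ ^ 2 := by
  have h := trace_opSum_inv_mul_opSum (X := X) B
  rw [hm.trace_opSum_mul] at h
  simp only [fun j => trace_opSum_inv_mul_opSum_irreducible (hρ.irreducible j) hB (hc j)] at h
  apply Complex.ofReal_injective
  rw [← h]
  push_cast
  simp only [mul_assoc]

end Bound

end ConjWalk

open Classical ConjWalk in
theorem mainTheorem5 {G : Type*} [Group G] [Fintype G]
    {ι : Type*} [Fintype ι] {V : ι → Type*}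
    [∀ j, AddCommGroup (V j)] [∀ j, Module ℂ (V j)] [∀ j, FiniteDimensional ℂ (V j)]
    (ρ : ∀ j, Representation ℂ G (V j)) (hρ : IsIrrepList ρ)
    (Q : G → ℝ) (hQ_nonneg : ∀ g, 0 ≤ Q g) (hQ_sum : ∑ g, Q g = 1)
    (hQ_conj : ∀ g h : G, IsConj g h → Q g = Q h)
    (X : Type*) [Fintype X] [MulAction G X] [MulAction.IsPretransitive G X] (x₀ : X) :
    (∃! a : ι → ℂ, ∀ g, (Q g : ℂ) = ∑ j, a j * (ρ j).character g) ∧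
    (∃! m : ι → ℕ, IsMultiplicities ρ (Representation.ofMulAction ℂ G X) m) ∧
    ∀ (a : ι → ℂ) (m : ι → ℕ),
      (∀ g, (Q g : ℂ) = ∑ j, a j * (ρ j).character g) →
      IsMultiplicities ρ (Representation.ofMulAction ℂ G X) m →
      ∀ N : ℕ,
        tvNorm (act (toGroupAlgebra (convPow Q N)) (basisVec x₀) - uniformVec X) ^ 2 ≤
          (1 / 4) * ∑ j with ¬ IsTrivialRep (ρ j),
            (m j : ℝ) * (Module.finrank ℂ (V j) : ℝ) *
              (‖a j‖ * (Fintype.card G : ℝ) / (Module.finrank ℂ (V j) : ℝ)) ^ (2 * N) := by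
  have hQ : ∀ g h, Q (h * g * h⁻¹) = Q g := fun g h => (hQ_conj _ _ (isConj_iff.2 ⟨h, rfl⟩)).symm
  have hQ' : ∀ g h, (Q (h * g * h⁻¹) : ℂ) = Q g := fun g h => by rw [hQ]
  have hX : FiniteDimensional ℂ (MonoidAlgebra ℂ X) := .of_basis (MonoidAlgebra.basis X ℂ)
  refine ⟨hρ.existsUnique_coeff hQ', hρ.existsUnique_isMultiplicities _, fun a m ha hm N => ?_⟩
  let B : G → ℝ := fun g => convPow Q N g - (Fintype.card G : ℝ)⁻¹
  have hB : ∀ g h, B (h * g * h⁻¹) = B g := fun g h => by simp only [B, convPow_conj_eq hQ]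
  have hBsub : (fun g => (B g : ℂ)) =
      fun g => (convPow Q N g : ℂ) - (fun _ => (Fintype.card G : ℂ)⁻¹) g := by
    funext g
    simp [B]
  let l : ι → ℂ := fun j => (∑ g, (Q g : ℂ) * (ρ j).character g) / Module.finrank ℂ (V j)
  -- Subtracting `1/|G|` removes the eigenvalue `1` on trivial constituents and changes nothing
  -- elsewhere.
  let c : ι → ℂ := fun j => if IsTrivialRep (ρ j) then 0 else l j ^ N
  have hc : ∀ j, opSum (ρ j) (fun g => (B g : ℂ)) = c j • (1 : V j →ₗ[ℂ] V j) := by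
    intro j
    by_cases hj : IsTrivialRep (ρ j)
    · have hsum : ∑ g, (B g : ℂ) = 0 := by
        rw [← Complex.ofReal_sum]
        simp [B, sum_convPow hQ_sum]
      simp only [opSum, apply_eq_of_isTrivialRep hj, ← Finset.sum_smul, hsum, c, if_pos hj]
    · rw [hBsub, opSum_sub, opSum_const_eq_zero (hρ.irreducible j) hj, sub_zero, opSum_convPow,
        opSum_eq_smul (hρ.irreducible j) hQ', smul_pow, one_pow]
      simp only [c, if_neg hj, l]
  have hl : ∀ j, ‖l j‖ = ‖a j‖ * Fintype.card G / Module.finrank ℂ (V j) := by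
    intro j
    have h := hρ.sum_mul_character_inv a j
    simp only [← ha] at h
    -- Orthogonality computes the sum against `χ g⁻¹`; as `Q` is real this is the conjugate of the
    -- one in `l j`, of equal norm.
    have h' : (starRingEnd ℂ) (∑ g, (Q g : ℂ) * (ρ j).character g) = Fintype.card G * a j := by
      rw [← h]
      simp only [map_sum, map_mul, Complex.conj_ofReal, conj_character]
    rw [norm_div, ← RCLike.norm_conj, h', norm_mul, Complex.norm_natCast, Complex.norm_natCast,
      mul_comm]
  have hvec : act (toGroupAlgebra (convPow Q N)) (basisVec x₀) - uniformVec X =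
      opSum (Representation.ofMulAction ℂ G X) (fun g => (B g : ℂ)) (MonoidAlgebra.single x₀ 1) := by
    rw [act, asAlgebraHom_toGroupAlgebra, uniformVec_eq (G := G) x₀, hBsub, opSum_sub]
    rfl
  rw [hvec]
  refine (tvNorm_sq_le _).trans_eq ?_
  congr 1
  have hsum := sum_sum_norm_sq_eq hρ hm hB hc
  rw [Finset.sum_congr rfl fun x _ => sum_norm_sq_opSum_single
    (fun g h => by rw [hB]) x x₀, Finset.sum_const, Finset.card_univ, nsmul_eq_mul] at hsum
  rw [hsum, Finset.sum_filter]
  refine Finset.sum_congr rfl fun j _ => ?_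
  by_cases hj : IsTrivialRep (ρ j)
  · simp [c, hj]
  · simp only [c, if_neg hj, hj, not_false_eq_true, if_true, norm_pow, hl, ← pow_mul, mul_comm N 2]
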